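/- An abelian heap is a (possibly empty) set with a ternary operation $[-,-,-]$ satisfying $[[a,b,c],d,e]=[a,b,[c,d,e]]$, $[a,b,b]=a=[b,b,a]$ and $[a,b,c]=[c,b,a]$. A unital truss is an abelian heap with an associative unital multiplication that distributes over $[-,-,-]$ on both sides. A unital left module over a unital truss $T$ is an abelian heap $M$ with an associative unital action of $T$ that distributes over the heap operations of $T$ and of $M$; morphisms are the heap morphisms that respect the action. Right modules are left modules over the opposite truss, and unital bimodules have two commuting unital actions, one on each side. For a right $T$-module $M$ and a left $T$-module $N$, the tensor product $M\otimes_T N$ is the abelian heap with the universal $T$-balanced map $M\times N\to M\otimes_T N$ that is a heap morphism in each variable; it carries the residual left action on $M$ and right action on $N$ when these are bimodules. Theorem. Let $T$ and $S$ be unital trusses. The following statements are equivalent. (1) The categories of unital left $T$-modules and of unital left $S$-modules are equivalent. (2) There exist a unital $S$-$T$-bimodule $P$ and a unital $T$-$S$-bimodule $Q$, together with an isomorphism of $S$-$S$-bimodules $\mathsf{ev}:P\otimes_T Q\to S$ and an isomorphism of $T$-$T$-bimodules $\mathsf{db}:T\to Q\otimes_S P$, such that $$(Q\otimes_S \mathsf{ev})\circ(\mathsf{db}\otimes_T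 Q)=\mathrm{id}_Q \quad\text{and}\quad (\mathsf{ev}\otimes_S P)\circ(P\otimes_T \mathsf{db})=\mathrm{id}_P .$$ (3) There exist a unital $S$-$T$-bimodule $P$ and a unital $T$-$S$-bimodule $Q$, together with an isomorphism of $S$-$S$-bimodules $\mathsf{db}':S\to P\otimes_T Q$ and an isomorphism of $T$-$T$-bimodules $\mathsf{ev}':Q\otimes_S P\to T$, such that $$(P\otimes_T \mathsf{ev}')\circ(\mathsf{db}'\otimes_S P)=\mathrm{id}_P \quad\text{and}\quad (\mathsf{ev}'\otimes_T Q)\circ(Q\otimes_S \mathsf{db}')=\mathrm{id}_Q .$$ In (2) and (3) the canonical isomorphisms $T\otimes_T N\cong N$, $M\otimes_T T\cong M$ (and likewise over $S$) and $(A\otimes B)\otimes C\cong A\otimes(B\otimes C)$ are suppressed. -/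

import Mathlib

/-!
Abelian heaps, unital trusses, unital (bi)modules over them, the category of unital left modules,
tensor products over a truss, and the zigzag identities.
-/

universe u

namespace TrussTheory

/-- An abelian heap: a (possibly empty) set with an associative ternary operation `br`, written
`[a, b, c]` in the comments, that satisfies the Mal'cev identities and `[a, b, c] = [c, b, a]`. -/
class AbHeap (H : Type*) where
  br : H → H → H → H
  br_assoc : ∀ a b c d e : H, br (br a b c) d e = br a b (br c d e)
  br_right : ∀ a b : H, br a b b = a
  br_left : ∀ a b : H, br b b a = a
  br_comm : ∀ a b c : H, br a b c = br c b a

/-- The transposition rule. -/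
theorem br_transpose {H : Type*} [AbHeap H] (a₁ a₂ a₃ b₁ b₂ b₃ c₁ c₂ c₃ : H) :
    AbHeap.br (AbHeap.br a₁ a₂ a₃) (AbHeap.br b₁ b₂ b₃) (AbHeap.br c₁ c₂ c₃) =
      AbHeap.br (AbHeap.br a₁ b₁ c₁) (AbHeap.br a₂ b₂ c₂) (AbHeap.br a₃ b₃ c₃) := by
  -- work in the retract at a base point, which is an abelian group
  let _ : Zero H := ⟨a₁⟩
  let _ : Add H := ⟨fun x y => AbHeap.br x a₁ y⟩
  let _ : Neg H := ⟨fun x => AbHeap.br a₁ x a₁⟩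
  let _ : AddGroup H := AddGroup.ofLeftAxioms (fun x y z => AbHeap.br_assoc _ _ _ _ _)
    (fun x => AbHeap.br_left _ _) (fun x => by
      change AbHeap.br (AbHeap.br a₁ x a₁) a₁ x = a₁
      rw [AbHeap.br_assoc, AbHeap.br_left, AbHeap.br_right])
  let _ : AddCommGroup H := { add_comm := fun x y => AbHeap.br_comm _ _ _ }
  have h : ∀ x y z : H, AbHeap.br x y z = x + -y + z := fun x y z => by
    change _ = AbHeap.br (AbHeap.br x a₁ (AbHeap.br a₁ y a₁)) a₁ z
    rw [← AbHeap.br_assoc x, AbHeap.br_right, AbHeap.br_assoc, AbHeap.br_left]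
  simp only [h]
  abel

/-- A unital truss: an abelian heap with an associative unital multiplication which distributes
over the heap operation on both sides. -/
class UnitalTruss (T : Type*) extends AbHeap T, Monoid T where
  mul_br : ∀ s t t' t'' : T, s * AbHeap.br t t' t'' = AbHeap.br (s * t) (s * t') (s * t'')
  br_mul : ∀ s t t' t'' : T, AbHeap.br t t' t'' * s = AbHeap.br (t * s) (t' * s) (t'' * s)

open AbHeap MulOpposite

/-- The opposite truss: same heap, opposite multiplication. -/
instance oppositeTruss (T : Type*) [UnitalTruss T] : UnitalTruss Tᵐᵒᵖ where
  br a b c := op (br a.unop b.unop c.unop)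
  br_assoc _ _ _ _ _ := congrArg op (br_assoc _ _ _ _ _)
  br_right a b := congrArg op (br_right a.unop b.unop)
  br_left a b := congrArg op (br_left a.unop b.unop)
  br_comm _ _ _ := congrArg op (br_comm _ _ _)
  mul_br s t t' t'' := congrArg op (UnitalTruss.br_mul s.unop t.unop t'.unop t''.unop)
  br_mul s t t' t'' := congrArg op (UnitalTruss.mul_br s.unop t.unop t'.unop t''.unop)

/-- A unital left `T`-module: an abelian heap with an associative unital action of `T` that
distributes over the heap operations of `T` and of `M`. A unital right `T`-module is a unital left
module over the opposite truss `Tᵐᵒᵖ`, and `m · t` is `op t • m`. -/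
class UModule (T : Type*) (M : Type*) [UnitalTruss T] [AbHeap M] extends MulAction T M where
  br_smul : ∀ (t t' t'' : T) (m : M), br t t' t'' • m = br (t • m) (t' • m) (t'' • m)
  smul_br : ∀ (t : T) (m m' m'' : M), t • br m m' m'' = br (t • m) (t • m') (t • m'')

/-- `T` as a left module over itself. -/
instance selfModule (T : Type*) [UnitalTruss T] : UModule T T where
  br_smul t t' t'' m := UnitalTruss.br_mul m t t' t''
  smul_br t m m' m'' := UnitalTruss.mul_br t m m' m''

/-- `T` as a right module over itself. -/
instance selfRightModule (T : Type*) [UnitalTruss T] : UModule Tᵐᵒᵖ T where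
  br_smul t t' t'' m := UnitalTruss.mul_br m t.unop t'.unop t''.unop
  smul_br t m m' m'' := UnitalTruss.br_mul t.unop m m' m''

/-- Morphisms of abelian heaps. -/
@[ext]
structure HeapHom (M N : Type*) [AbHeap M] [AbHeap N] where
  toFun : M → N
  map_br : ∀ a b c : M, toFun (br a b c) = br (toFun a) (toFun b) (toFun c)

instance {M N : Type*} [AbHeap M] [AbHeap N] : CoeFun (HeapHom M N) (fun _ => M → N) :=
  ⟨HeapHom.toFun⟩

/-- The identity morphism. -/
def HeapHom.id (M : Type*) [AbHeap M] : HeapHom M M := ⟨fun m => m, fun _ _ _ => rfl⟩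

/-- Composition of heap morphisms, `g.comp f = g ∘ f`. -/
def HeapHom.comp {M N K : Type*} [AbHeap M] [AbHeap N] [AbHeap K]
    (g : HeapHom N K) (f : HeapHom M N) : HeapHom M K :=
  ⟨fun m => g (f m), fun a b c => by rw [f.map_br, g.map_br]⟩

/-- `T`-linear maps of left `T`-modules. Right linear maps are `Tᵐᵒᵖ`-linear maps. -/
@[ext]
structure LinHom (T : Type*) (M N : Type*) [UnitalTruss T] [AbHeap M] [AbHeap N]
    [UModule T M] [UModule T N] extends HeapHom M N where
  map_smul : ∀ (t : T) (m : M), toFun (t • m) = t • toFun m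

/-- The identity linear map. -/
def LinHom.id (T M : Type*) [UnitalTruss T] [AbHeap M] [UModule T M] : LinHom T M M :=
  ⟨HeapHom.id M, fun _ _ => rfl⟩

/-- Composition of linear maps, `g.comp f = g ∘ f`. -/
def LinHom.comp {T M N K : Type*} [UnitalTruss T] [AbHeap M] [AbHeap N] [AbHeap K]
    [UModule T M] [UModule T N] [UModule T K]
    (g : LinHom T N K) (f : LinHom T M N) : LinHom T M K :=
  ⟨g.toHeapHom.comp f.toHeapHom, fun t m => by
    change g.toFun (f.toFun (t • m)) = t • g.toFun (f.toFun m)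
    rw [f.map_smul, g.map_smul]⟩

/-- Isomorphisms of `S`-`T`-bimodules: bijective heap morphisms compatible with both actions. -/
structure BimodIso (S T : Type*) (M N : Type*) [UnitalTruss S] [UnitalTruss T]
    [AbHeap M] [AbHeap N] [UModule S M] [UModule Tᵐᵒᵖ M] [UModule S N] [UModule Tᵐᵒᵖ N]
    extends M ≃ N where
  map_br : ∀ a b c : M, toFun (br a b c) = br (toFun a) (toFun b) (toFun c)
  map_smul : ∀ (s : S) (m : M), toFun (s • m) = s • toFun m
  map_op_smul : ∀ (t : T) (m : M), toFun (op t • m) = op t • toFun m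

section BimodIso

variable {S T M N : Type*} [UnitalTruss S] [UnitalTruss T] [AbHeap M] [AbHeap N]
  [UModule S M] [UModule Tᵐᵒᵖ M] [UModule S N] [UModule Tᵐᵒᵖ N]

/-- The underlying left linear map. -/
def BimodIso.toLeft (f : BimodIso S T M N) : LinHom S M N :=
  ⟨⟨f.toFun, f.map_br⟩, f.map_smul⟩

/-- The underlying right linear map. -/
def BimodIso.toRight (f : BimodIso S T M N) : LinHom Tᵐᵒᵖ M N :=
  ⟨⟨f.toFun, f.map_br⟩, fun t m => f.map_op_smul t.unop m⟩

end BimodIso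

/-! ### The category of unital left modules -/

/-- Objects of the category of unital left `T`-modules. -/
structure UMod (T : Type u) [UnitalTruss T] where
  carrier : Type u
  [heap : AbHeap carrier]
  [module : UModule T carrier]

attribute [instance] UMod.heap UMod.module

instance (T : Type u) [UnitalTruss T] : CategoryTheory.Category (UMod T) where
  Hom M N := LinHom T M.carrier N.carrier
  id M := LinHom.id T M.carrier
  comp f g := g.comp f

/-! ### Unital bimodules -/

/-- A unital `S`-`T`-bimodule: a unital left `S`-module and unital right `T`-module on the same
abelian heap, with commuting actions. -/
structure UBimod (S T : Type u) [UnitalTruss S] [UnitalTruss T] where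
  carrier : Type u
  [heap : AbHeap carrier]
  [left : UModule S carrier]
  [right : UModule Tᵐᵒᵖ carrier]
  [comm : SMulCommClass S Tᵐᵒᵖ carrier]

attribute [instance] UBimod.heap UBimod.left UBimod.right UBimod.comm

/-! ### Tensor products -/

section Tensor

/-- Formal iterated brackets of pairs. -/
inductive PreTensor (M N : Type*) : Type _
  | pure : M → N → PreTensor M N
  | br : PreTensor M N → PreTensor M N → PreTensor M N → PreTensor M N

/-- The least congruence on formal brackets which contains the axioms of an abelian heap,
bilinearity, and `T`-balancedness. -/
inductive TensorRel (T : Type*) {M N : Type*} [UnitalTruss T] [AbHeap M] [AbHeap N]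
    [UModule Tᵐᵒᵖ M] [UModule T N] : PreTensor M N → PreTensor M N → Prop
  | refl (x) : TensorRel T x x
  | symm {x y} : TensorRel T x y → TensorRel T y x
  | trans {x y z} : TensorRel T x y → TensorRel T y z → TensorRel T x z
  | congr {x y z x' y' z'} : TensorRel T x x' → TensorRel T y y' → TensorRel T z z' →
      TensorRel T (.br x y z) (.br x' y' z')
  | assoc (a b c d e) : TensorRel T (.br (.br a b c) d e) (.br a b (.br c d e))
  | right (a b) : TensorRel T (.br a b b) a
  | left (a b) : TensorRel T (.br b b a) a
  | comm (a b c) : TensorRel T (.br a b c) (.br c b a)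
  | linLeft (m m' m'' : M) (n : N) :
      TensorRel T (.pure (br m m' m'') n) (.br (.pure m n) (.pure m' n) (.pure m'' n))
  | linRight (m : M) (n n' n'' : N) :
      TensorRel T (.pure m (br n n' n'')) (.br (.pure m n) (.pure m n') (.pure m n''))
  | balance (m : M) (t : T) (n : N) : TensorRel T (.pure (op t • m) n) (.pure m (t • n))

/-- The congruence as a setoid. -/
def tensorSetoid (T M N : Type*) [UnitalTruss T] [AbHeap M] [AbHeap N]
    [UModule Tᵐᵒᵖ M] [UModule T N] : Setoid (PreTensor M N) :=
  ⟨TensorRel T, ⟨.refl, .symm, .trans⟩⟩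

/-- The tensor product `M ⊗_T N` of a right `T`-module `M` and a left `T`-module `N`: the abelian
heap generated by the simple tensors subject to bilinearity and `T`-balancedness. -/
def Tensor (T M N : Type*) [UnitalTruss T] [AbHeap M] [AbHeap N]
    [UModule Tᵐᵒᵖ M] [UModule T N] : Type _ :=
  Quotient (tensorSetoid T M N)

namespace Tensor

section Basic

variable {T M N : Type*} [UnitalTruss T] [AbHeap M] [AbHeap N] [UModule Tᵐᵒᵖ M] [UModule T N]

instance : AbHeap (Tensor T M N) where
  br x y z := Quotient.liftOn x
    (fun a => Quotient.map₂ (PreTensor.br a)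
      (fun _ _ h₂ _ _ h₃ => TensorRel.congr (TensorRel.refl a) h₂ h₃) y z)
    (fun a a' h => by
      obtain ⟨y⟩ := y
      obtain ⟨z⟩ := z
      exact Quotient.sound (TensorRel.congr h (TensorRel.refl y) (TensorRel.refl z)))
  br_assoc := by
    rintro ⟨a⟩ ⟨b⟩ ⟨c⟩ ⟨d⟩ ⟨e⟩; exact Quotient.sound (TensorRel.assoc a b c d e)
  br_right := by rintro ⟨a⟩ ⟨b⟩; exact Quotient.sound (TensorRel.right a b)
  br_left := by rintro ⟨a⟩ ⟨b⟩; exact Quotient.sound (TensorRel.left a b)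
  br_comm := by rintro ⟨a⟩ ⟨b⟩ ⟨c⟩; exact Quotient.sound (TensorRel.comm a b c)

variable (T) in
/-- The simple tensor `m ⊗ n`. -/
def tmul (m : M) (n : N) : Tensor T M N := Quotient.mk (tensorSetoid T M N) (.pure m n)

theorem br_tmul (m m' m'' : M) (n : N) :
    tmul T (br m m' m'') n = br (tmul T m n) (tmul T m' n) (tmul T m'' n) :=
  Quotient.sound (TensorRel.linLeft m m' m'' n)

theorem tmul_br (m : M) (n n' n'' : N) :
    tmul T m (br n n' n'') = br (tmul T m n) (tmul T m n') (tmul T m n'') :=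
  Quotient.sound (TensorRel.linRight m n n' n'')

theorem balance (m : M) (t : T) (n : N) : tmul T (op t • m) n = tmul T m (t • n) :=
  Quotient.sound (TensorRel.balance m t n)

theorem ind {p : Tensor T M N → Prop} (hp : ∀ m n, p (tmul T m n))
    (hb : ∀ x y z, p x → p y → p z → p (br x y z)) (x : Tensor T M N) : p x := by
  obtain ⟨x⟩ := x
  induction x with
  | pure m n => exact hp m n
  | br x y z hx hy hz => exact hb _ _ _ hx hy hz

/-- Heap morphisms out of a tensor product are determined on simple tensors. -/
theorem hom_ext {H : Type*} [AbHeap H] {f g : HeapHom (Tensor T M N) H}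
    (h : ∀ m n, f (tmul T m n) = g (tmul T m n)) (x : Tensor T M N) : f x = g x := by
  induction x using ind with
  | hp m n => exact h m n
  | hb x y z hx hy hz => rw [f.map_br, g.map_br, hx, hy, hz]

end Basic

/-- `T`-balanced bilinear maps `M × N → H`. -/
structure Balanced (T M N H : Type*) [UnitalTruss T] [AbHeap M] [AbHeap N] [AbHeap H]
    [UModule Tᵐᵒᵖ M] [UModule T N] where
  toFun : M → N → H
  br_left : ∀ m m' m'' n, toFun (br m m' m'') n = br (toFun m n) (toFun m' n) (toFun m'' n)
  br_right : ∀ m n n' n'', toFun m (br n n' n'') = br (toFun m n) (toFun m n') (toFun m n'')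
  balanced : ∀ m (t : T) n, toFun (op t • m) n = toFun m (t • n)

section Lift

variable {T M N H : Type*} [UnitalTruss T] [AbHeap M] [AbHeap N] [AbHeap H]
  [UModule Tᵐᵒᵖ M] [UModule T N]

/-- Evaluation of a formal bracket along a function of two variables. -/
def preLift (f : M → N → H) : PreTensor M N → H
  | .pure m n => f m n
  | .br x y z => AbHeap.br (preLift f x) (preLift f y) (preLift f z)

theorem preLift_congr (f : Balanced T M N H) {x y : PreTensor M N} (h : TensorRel T x y) :
    preLift f.toFun x = preLift f.toFun y := by
  induction h with
  | refl => rfl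
  | symm _ h => exact h.symm
  | trans _ _ h h' => exact h.trans h'
  | congr _ _ _ h h' h'' => simp only [preLift, h, h', h'']
  | assoc => exact br_assoc _ _ _ _ _
  | right => exact AbHeap.br_right _ _
  | left => exact AbHeap.br_left _ _
  | comm => exact br_comm _ _ _
  | linLeft => exact f.br_left _ _ _ _
  | linRight => exact f.br_right _ _ _ _
  | balance => exact f.balanced _ _ _

/-- The heap morphism `M ⊗_T N → H` induced by a balanced bilinear map. -/
def lift (f : Balanced T M N H) : HeapHom (Tensor T M N) H where
  toFun := Quotient.lift (preLift f.toFun) (fun _ _ h => preLift_congr f h)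
  map_br := by rintro ⟨a⟩ ⟨b⟩ ⟨c⟩; rfl

@[simp]
theorem lift_tmul (f : Balanced T M N H) (m : M) (n : N) :
    lift f (tmul T m n) = f.toFun m n := rfl

/-- The universal property of the tensor product. -/
theorem existsUnique_lift (f : Balanced T M N H) :
    ∃! g : HeapHom (Tensor T M N) H, ∀ m n, g (tmul T m n) = f.toFun m n :=
  ⟨lift f, fun _ _ => rfl, fun g hg => HeapHom.ext (funext (hom_ext fun m n => by
    rw [hg, lift_tmul]))⟩

end Lift

/-- `f ⊗ g : M ⊗_T N → M' ⊗_T N'`, `m ⊗ n ↦ f m ⊗ g n`. -/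
def map {T M N M' N' : Type*} [UnitalTruss T] [AbHeap M] [AbHeap N] [AbHeap M'] [AbHeap N']
    [UModule Tᵐᵒᵖ M] [UModule T N] [UModule Tᵐᵒᵖ M'] [UModule T N']
    (f : LinHom Tᵐᵒᵖ M M') (g : LinHom T N N') : HeapHom (Tensor T M N) (Tensor T M' N') :=
  lift
    { toFun := fun m n => tmul T (f.toFun m) (g.toFun n)
      br_left := fun m m' m'' n => by rw [f.map_br, br_tmul]
      br_right := fun m n n' n'' => by rw [g.map_br, tmul_br]
      balanced := fun m t n => by rw [f.map_smul, g.map_smul, balance] }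

section Actions

variable {S T R M N : Type*} [UnitalTruss S] [UnitalTruss T] [UnitalTruss R]
  [AbHeap M] [AbHeap N] [UModule Tᵐᵒᵖ M] [UModule T N]

/-- Left action on the first factor. -/
def smulLeft [UModule S M] [SMulCommClass S Tᵐᵒᵖ M] (s : S) :
    HeapHom (Tensor T M N) (Tensor T M N) :=
  map ⟨⟨fun m => s • m, UModule.smul_br s⟩, fun t m => smul_comm s t m⟩ (LinHom.id T N)

/-- Right action on the second factor. -/
def smulRight [UModule Rᵐᵒᵖ N] [SMulCommClass T Rᵐᵒᵖ N] (r : Rᵐᵒᵖ) :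
    HeapHom (Tensor T M N) (Tensor T M N) :=
  map (LinHom.id Tᵐᵒᵖ M)
    ⟨⟨fun n => r • n, UModule.smul_br r⟩, fun t n => (smul_comm t r n).symm⟩

/-- If `M` is an `S`-`T`-bimodule, then `M ⊗_T N` is a left `S`-module,
`s • (m ⊗ n) = (s • m) ⊗ n`. -/
instance leftModule [UModule S M] [SMulCommClass S Tᵐᵒᵖ M] : UModule S (Tensor T M N) where
  smul s := smulLeft s
  one_smul x := by
    change smulLeft (1 : S) x = x
    induction x using ind with
    | hp m n => exact congrArg (fun m => tmul T m n) (one_smul S m)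
    | hb x y z hx hy hz => rw [HeapHom.map_br, hx, hy, hz]
  mul_smul s s' x := by
    change smulLeft (s * s') x = smulLeft s (smulLeft s' x)
    induction x using ind with
    | hp m n => exact congrArg (fun m => tmul T m n) (mul_smul s s' m)
    | hb x y z hx hy hz => simp only [HeapHom.map_br, hx, hy, hz]
  br_smul s s' s'' x := by
    change smulLeft (br s s' s'') x = br (smulLeft s x) (smulLeft s' x) (smulLeft s'' x)
    induction x using ind with
    | hp m n =>
      exact (congrArg (fun m => tmul T m n) (UModule.br_smul s s' s'' m)).trans (br_tmul _ _ _ _)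
    | hb x y z hx hy hz =>
      simp only [HeapHom.map_br, hx, hy, hz]
      exact br_transpose _ _ _ _ _ _ _ _ _
  smul_br s := (smulLeft s).map_br

/-- If `N` is a `T`-`R`-bimodule, then `M ⊗_T N` is a right `R`-module,
`(m ⊗ n) · r = m ⊗ (n · r)`. -/
instance rightModule [UModule Rᵐᵒᵖ N] [SMulCommClass T Rᵐᵒᵖ N] :
    UModule Rᵐᵒᵖ (Tensor T M N) where
  smul r := smulRight r
  one_smul x := by
    change smulRight (1 : Rᵐᵒᵖ) x = x
    induction x using ind with
    | hp m n => exact congrArg (tmul T m) (one_smul Rᵐᵒᵖ n)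
    | hb x y z hx hy hz => rw [HeapHom.map_br, hx, hy, hz]
  mul_smul s s' x := by
    change smulRight (s * s') x = smulRight s (smulRight s' x)
    induction x using ind with
    | hp m n => exact congrArg (tmul T m) (mul_smul s s' n)
    | hb x y z hx hy hz => simp only [HeapHom.map_br, hx, hy, hz]
  br_smul s s' s'' x := by
    change smulRight (br s s' s'') x = br (smulRight s x) (smulRight s' x) (smulRight s'' x)
    induction x using ind with
    | hp m n =>
      exact (congrArg (tmul T m) (UModule.br_smul s s' s'' n)).trans (tmul_br _ _ _ _)
    | hb x y z hx hy hz =>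
      simp only [HeapHom.map_br, hx, hy, hz]
      exact br_transpose _ _ _ _ _ _ _ _ _
  smul_br s := (smulRight s).map_br

theorem smul_tmul [UModule S M] [SMulCommClass S Tᵐᵒᵖ M] (s : S) (m : M) (n : N) :
    s • tmul T m n = tmul T (s • m) n := rfl

theorem op_smul_tmul [UModule Rᵐᵒᵖ N] [SMulCommClass T Rᵐᵒᵖ N] (r : Rᵐᵒᵖ) (m : M) (n : N) :
    r • tmul T m n = tmul T m (r • n) := rfl

/-- The tensor product of an `S`-`T`- and a `T`-`R`-bimodule is an `S`-`R`-bimodule. -/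
instance [UModule S M] [SMulCommClass S Tᵐᵒᵖ M] [UModule Rᵐᵒᵖ N] [SMulCommClass T Rᵐᵒᵖ N] :
    SMulCommClass S Rᵐᵒᵖ (Tensor T M N) where
  smul_comm s r x := by
    induction x using ind with
    | hp m n => rfl
    | hb x y z hx hy hz => simp only [UModule.smul_br, hx, hy, hz]

end Actions

section Unitors

variable (T M N : Type*) [UnitalTruss T] [AbHeap M] [AbHeap N] [UModule Tᵐᵒᵖ M] [UModule T N]

/-- The left unitor `T ⊗_T N → N`, `t ⊗ n ↦ t • n`. -/
def lUnit : HeapHom (Tensor T T N) N :=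
  lift
    { toFun := fun t n => t • n
      br_left := UModule.br_smul
      br_right := UModule.smul_br
      balanced := fun s t n => mul_smul s t n }

/-- The inverse `N → T ⊗_T N`, `n ↦ 1 ⊗ n`, of the left unitor. -/
def lUnitInv : HeapHom N (Tensor T T N) := ⟨fun n => tmul T 1 n, tmul_br 1⟩

/-- The right unitor `M ⊗_T T → M`, `m ⊗ t ↦ m · t`. -/
def rUnit : HeapHom (Tensor T M T) M :=
  lift
    { toFun := fun m t => op t • m
      br_left := fun m m' m'' t => UModule.smul_br (op t) m m' m''
      br_right := fun m t t' t'' => UModule.br_smul (op t) (op t') (op t'') m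
      balanced := fun m s t => (mul_smul (op t) (op s) m).symm }

/-- The inverse `M → M ⊗_T T`, `m ↦ m ⊗ 1`, of the right unitor. -/
def rUnitInv : HeapHom M (Tensor T M T) :=
  ⟨fun m => tmul T m 1, fun m m' m'' => br_tmul m m' m'' 1⟩

end Unitors

section Associator

variable (S T A B C : Type*) [UnitalTruss S] [UnitalTruss T] [AbHeap A] [AbHeap B] [AbHeap C]
  [UModule Sᵐᵒᵖ A] [UModule S B] [UModule Tᵐᵒᵖ B] [SMulCommClass S Tᵐᵒᵖ B] [UModule T C]

/-- The map `A ⊗_S B → A ⊗_S (B ⊗_T C)`, `a ⊗ b ↦ a ⊗ (b ⊗ c)`, for fixed `c`. -/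
def assocAux (c : C) : HeapHom (Tensor S A B) (Tensor S A (Tensor T B C)) :=
  map (LinHom.id Sᵐᵒᵖ A) ⟨⟨fun b => tmul T b c, fun b b' b'' => br_tmul b b' b'' c⟩,
    fun _ _ => rfl⟩

/-- The associator `(A ⊗_S B) ⊗_T C → A ⊗_S (B ⊗_T C)`, `(a ⊗ b) ⊗ c ↦ a ⊗ (b ⊗ c)`. -/
def assoc : HeapHom (Tensor T (Tensor S A B) C) (Tensor S A (Tensor T B C)) :=
  lift
    { toFun := fun x c => assocAux S T A B C c x
      br_left := fun x x' x'' c => (assocAux S T A B C c).map_br x x' x''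
      br_right := fun x c c' c'' => by
        induction x using ind with
        | hp a b =>
          exact (congrArg (tmul S a) (tmul_br (T := T) b c c' c'')).trans (tmul_br _ _ _ _)
        | hb x y z hx hy hz =>
          simp only [HeapHom.map_br, hx, hy, hz]
          exact br_transpose _ _ _ _ _ _ _ _ _
      balanced := fun x t c => by
        induction x using ind with
        | hp a b => exact congrArg (tmul S a) (balance (T := T) b t c)
        | hb x y z hx hy hz => simp only [UModule.smul_br, HeapHom.map_br, hx, hy, hz] }

/-- The map `B ⊗_T C → (A ⊗_S B) ⊗_T C`, `b ⊗ c ↦ (a ⊗ b) ⊗ c`, for fixed `a`. -/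
def assocInvAux (a : A) : HeapHom (Tensor T B C) (Tensor T (Tensor S A B) C) :=
  map ⟨⟨fun b => tmul S a b, fun b b' b'' => tmul_br a b b' b''⟩, fun _ _ => rfl⟩ (LinHom.id T C)

/-- The inverse associator `A ⊗_S (B ⊗_T C) → (A ⊗_S B) ⊗_T C`, `a ⊗ (b ⊗ c) ↦ (a ⊗ b) ⊗ c`. -/
def assocInv : HeapHom (Tensor S A (Tensor T B C)) (Tensor T (Tensor S A B) C) :=
  lift
    { toFun := fun a x => assocInvAux S T A B C a x
      br_left := fun a a' a'' x => by
        induction x using ind with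
        | hp b c =>
          exact (congrArg (fun y => tmul T y c) (br_tmul (T := S) a a' a'' b)).trans
            (br_tmul _ _ _ _)
        | hb x y z hx hy hz =>
          simp only [HeapHom.map_br, hx, hy, hz]
          exact br_transpose _ _ _ _ _ _ _ _ _
      br_right := fun a => (assocInvAux S T A B C a).map_br
      balanced := fun a s x => by
        induction x using ind with
        | hp b c => exact congrArg (fun y => tmul T y c) (balance (T := S) a s b)
        | hb x y z hx hy hz => simp only [UModule.smul_br, HeapHom.map_br, hx, hy, hz] }

end Associator

end Tensor

end Tensor

/-! ### The zigzag identities -/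

section Zigzag

variable {T S : Type u} [UnitalTruss T] [UnitalTruss S] (A : UBimod T S) (B : UBimod S T)
  (db : BimodIso T T T (Tensor S A.carrier B.carrier))
  (ev : BimodIso S S (Tensor T B.carrier A.carrier) S)

/-- The identity `(A ⊗_S ev) ∘ (db ⊗_T A) = id_A`, with the canonical isomorphisms made explicit:
the composite `A → T ⊗_T A → (A ⊗_S B) ⊗_T A → A ⊗_S (B ⊗_T A) → A ⊗_S S → A` is the identity. -/
def Zigzag₁ : Prop :=
  (Tensor.rUnit S A.carrier).comp
    ((Tensor.map (LinHom.id Sᵐᵒᵖ A.carrier) ev.toLeft).comp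
      ((Tensor.assoc S T A.carrier B.carrier A.carrier).comp
        ((Tensor.map db.toRight (LinHom.id T A.carrier)).comp
          (Tensor.lUnitInv T A.carrier)))) = HeapHom.id A.carrier

/-- The identity `(ev ⊗_S B) ∘ (B ⊗_T db) = id_B`, with the canonical isomorphisms made explicit:
the composite `B → B ⊗_T T → B ⊗_T (A ⊗_S B) → (B ⊗_T A) ⊗_S B → S ⊗_S B → B` is the identity. -/
def Zigzag₂ : Prop :=
  (Tensor.lUnit S B.carrier).comp
    ((Tensor.map ev.toRight (LinHom.id S B.carrier)).comp
      ((Tensor.assocInv T S B.carrier A.carrier B.carrier).comp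
        ((Tensor.map (LinHom.id Tᵐᵒᵖ B.carrier) db.toLeft).comp
          (Tensor.rUnitInv T B.carrier)))) = HeapHom.id B.carrier

end Zigzag

end TrussTheory

open TrussTheory

namespace TrussTheory

open AbHeap MulOpposite CategoryTheory

/-! This is Morita theory without additive structure, and with empty modules allowed.

Passing from an equivalence `E` with functor `F` and inverse `G` to bimodules follows Eilenberg and
Watts: take `P = F T` and `Q = G S`. Right multiplications are endomorphisms of the left module `T`,
so `F` makes `T` act on `F T` from the right. That this action distributes over the brackets of `T`
needs `F` to preserve pointwise brackets of linear maps; `mapLin_br` derives this from fullness and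
faithfulness alone, since the bracket is determined by the Mal'cev identities. The comparison `F T ⊗
M → F M` is then bijective (`bijective_comparison`), with inverse built from the adjunction between
`F` and `G` and from `Hom (F T, N) ≅ Hom (T, G N) ≅ G N`. Composed with the counit, it yields `ev :
F T ⊗ G S ≅ F (G S) ≅ S`; the same construction for the reversed equivalence yields `G S ⊗ F T ≅ T`,
whose inverse is `db`.

On simple tensors the zigzag identities become the associativity laws `ev (p ⊗ q) · p' = p · db⁻¹ (q
⊗ p')` and `db⁻¹ (q ⊗ p) · q' = q · ev (p ⊗ q')` (`zigzag₁_iff`, `zigzag₂_iff`). For the bimodules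
above they follow from naturality of the counit and a triangle identity (`evalIso_smul`). In this
form the pair of identities is visibly unchanged when `ev` and `db` are inverted and exchange roles,
so (2) and (3) are equivalent.

Conversely, `P ⊗ (Q ⊗ N) ≅ (P ⊗ Q) ⊗ N ≅ S ⊗ N ≅ N`, and symmetrically for `Q ⊗ (P ⊗ M)`, so
tensoring with `P` and with `Q` is an equivalence. -/

/-! ### Bimodule isomorphisms -/

/-- The inverse of an isomorphism of bimodules. -/
def BimodIso.symm {S T M N : Type*} [UnitalTruss S] [UnitalTruss T]
    [AbHeap M] [AbHeap N] [UModule S M] [UModule Tᵐᵒᵖ M] [UModule S N] [UModule Tᵐᵒᵖ N]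
    (f : BimodIso S T M N) : BimodIso S T N M where
  toEquiv := f.toEquiv.symm
  map_br a b c := f.toEquiv.symm_apply_eq.2 <| by
    refine Eq.trans ?_ (f.map_br _ _ _).symm
    exact (congr (congr (congrArg br (f.toEquiv.apply_symm_apply a))
      (f.toEquiv.apply_symm_apply b)) (f.toEquiv.apply_symm_apply c)).symm
  map_smul s m := f.toEquiv.symm_apply_eq.2 <|
    ((f.map_smul s _).trans (congrArg (s • ·) (f.toEquiv.apply_symm_apply m))).symm
  map_op_smul t m := f.toEquiv.symm_apply_eq.2 <|
    ((f.map_op_smul t _).trans (congrArg (op t • ·) (f.toEquiv.apply_symm_apply m))).symm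

/-! ### Zigzag identities on simple tensors -/

section Zigzag

variable {T S : Type u} [UnitalTruss T] [UnitalTruss S] (A : UBimod T S) (B : UBimod S T)
  (db : BimodIso T T T (Tensor S A.carrier B.carrier))
  (ev : BimodIso S S (Tensor T B.carrier A.carrier) S)

/-- The map `A ⊗ B → A`, `a ⊗ b ↦ a · ev (b ⊗ a')`, for fixed `a'`. -/
def contractRight (a' : A.carrier) : HeapHom (Tensor S A.carrier B.carrier) A.carrier :=
  (Tensor.rUnit S A.carrier).comp
    ((Tensor.map (LinHom.id Sᵐᵒᵖ A.carrier) ev.toLeft).comp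
      (Tensor.assocAux S T A.carrier B.carrier A.carrier a'))

theorem contractRight_smul (a' : A.carrier) (t : T) (x : Tensor S A.carrier B.carrier) :
    contractRight A B ev a' (t • x) = t • contractRight A B ev a' x := by
  induction x using Tensor.ind with
  | hp a b => exact (smul_comm t (op (ev.toFun (Tensor.tmul T b a'))) a).symm
  | hb x y z hx hy hz => simp only [UModule.smul_br, HeapHom.map_br, hx, hy, hz]

/-- The map `A ⊗ B → B`, `a ⊗ b' ↦ ev (b ⊗ a) · b'`, for fixed `b`. -/
def contractLeft (b : B.carrier) : HeapHom (Tensor S A.carrier B.carrier) B.carrier :=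
  (Tensor.lUnit S B.carrier).comp
    ((Tensor.map ev.toRight (LinHom.id S B.carrier)).comp
      (Tensor.assocInvAux T S B.carrier A.carrier B.carrier b))

theorem contractLeft_op_smul (b : B.carrier) (t : T) (x : Tensor S A.carrier B.carrier) :
    contractLeft A B ev b (op t • x) = op t • contractLeft A B ev b x := by
  induction x using Tensor.ind with
  | hp a b' => exact smul_comm (ev.toFun (Tensor.tmul T b a)) (op t) b'
  | hb x y z hx hy hz => simp only [UModule.smul_br, HeapHom.map_br, hx, hy, hz]

/-- The zigzag says that contraction against `a'` sends `db 1` to `a'`. Contraction is left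
`T`-linear, so it sends `db t` to `t • a'`, which is the right-hand condition at `db t = a ⊗ b`. In
the other direction, two heap morphisms that agree on simple tensors agree at `db 1`. -/
theorem zigzag₁_iff : Zigzag₁ A B db ev ↔ ∀ a b a',
    db.toEquiv.symm (Tensor.tmul S a b) • a' = op (ev.toFun (Tensor.tmul T b a')) • a := by
  have key : Zigzag₁ A B db ev ↔ ∀ a', contractRight A B ev a' (db.toFun 1) = a' :=
    ⟨fun h a' => congrArg (fun f => HeapHom.toFun f a') h, fun h => HeapHom.ext (funext h)⟩
  rw [key]
  constructor
  · intro h a b a'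
    have ht : ∀ t : T, contractRight A B ev a' (db.toFun t) = t • a' := fun t => by
      conv_lhs => rw [← mul_one t]
      rw [← smul_eq_mul, db.map_smul, contractRight_smul, h]
    rw [← ht]
    exact congrArg _ (db.toEquiv.apply_symm_apply _)
  · intro h a'
    let g : HeapHom (Tensor S A.carrier B.carrier) A.carrier :=
      ⟨fun x => db.symm.toFun x • a', fun x y z => by rw [db.symm.map_br, UModule.br_smul]⟩
    have hg := Tensor.hom_ext (f := contractRight A B ev a') (g := g)
      (fun a b => (h a b a').symm) (db.toFun 1)
    rw [hg]
    exact (congrArg (· • a') (db.toEquiv.symm_apply_apply 1)).trans (one_smul T a')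

theorem zigzag₂_iff : Zigzag₂ A B db ev ↔ ∀ b a b',
    ev.toFun (Tensor.tmul T b a) • b' = op (db.toEquiv.symm (Tensor.tmul S a b')) • b := by
  have key : Zigzag₂ A B db ev ↔ ∀ b, contractLeft A B ev b (db.toFun 1) = b :=
    ⟨fun h b => congrArg (fun f => HeapHom.toFun f b) h, fun h => HeapHom.ext (funext h)⟩
  rw [key]
  constructor
  · intro h b a b'
    have ht : ∀ t : T, contractLeft A B ev b (db.toFun t) = op t • b := fun t => by
      conv_lhs => rw [← one_mul t]
      rw [← op_smul_eq_mul, db.map_op_smul, contractLeft_op_smul, h]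
    rw [← ht]
    exact (congrArg (contractLeft A B ev b).toFun
      (db.toEquiv.apply_symm_apply (Tensor.tmul S a b'))).symm
  · intro h b
    let g : HeapHom (Tensor S A.carrier B.carrier) B.carrier :=
      ⟨fun x => op (db.symm.toFun x) • b, fun x y z => by
        rw [db.symm.map_br]
        exact UModule.br_smul (op _) (op _) (op _) b⟩
    have hg := Tensor.hom_ext (f := contractLeft A B ev b) (g := g)
      (fun a b' => h b a b') (db.toFun 1)
    rw [hg]
    exact (congrArg (fun t => op t • b) (db.toEquiv.symm_apply_apply 1)).trans (one_smul Tᵐᵒᵖ b)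

/-- On simple tensors both zigzags are literally the same equation. -/
theorem zigzag₁_symm (h : Zigzag₂ A B db ev) : Zigzag₁ B A ev.symm db.symm :=
  (zigzag₁_iff _ _ _ _).2 ((zigzag₂_iff _ _ _ _).1 h)

theorem zigzag₂_symm (h : Zigzag₁ A B db ev) : Zigzag₂ B A ev.symm db.symm :=
  (zigzag₂_iff _ _ _ _).2 ((zigzag₁_iff _ _ _ _).1 h)

end Zigzag

/-! ### Equivalences given by tensoring -/

section Tensor

theorem Tensor.bijective_lUnit (T N : Type*) [UnitalTruss T] [AbHeap N] [UModule T N] :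
    Function.Bijective (Tensor.lUnit T N) := by
  refine Function.bijective_iff_has_inverse.2 ⟨Tensor.lUnitInv T N, fun x => ?_, one_smul T⟩
  refine Tensor.hom_ext (f := (Tensor.lUnitInv T N).comp (Tensor.lUnit T N)) (g := HeapHom.id _)
    (fun t n => ?_) x
  -- The scalar moves across the tensor sign: `1 ⊗ t • n = (1 · t) ⊗ n = t ⊗ n`.
  refine (Tensor.balance (1 : T) t n).symm.trans (congrArg (Tensor.tmul T · n) ?_)
  exact one_mul t

theorem Tensor.bijective_assocInv (S T A B C : Type*) [UnitalTruss S] [UnitalTruss T]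
    [AbHeap A] [AbHeap B] [AbHeap C] [UModule Sᵐᵒᵖ A] [UModule S B] [UModule Tᵐᵒᵖ B]
    [SMulCommClass S Tᵐᵒᵖ B] [UModule T C] : Function.Bijective (Tensor.assocInv S T A B C) := by
  refine Function.bijective_iff_has_inverse.2 ⟨Tensor.assoc S T A B C, fun x => ?_, fun x => ?_⟩
  · refine Tensor.hom_ext (f := (Tensor.assoc S T A B C).comp (Tensor.assocInv S T A B C))
      (g := HeapHom.id _) (fun a y => ?_) x
    exact Tensor.hom_ext
      (f := (Tensor.assoc S T A B C).comp (Tensor.assocInvAux S T A B C a))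
      (g := ⟨Tensor.tmul S a, Tensor.tmul_br a⟩) (fun b c => rfl) y
  · refine Tensor.hom_ext (f := (Tensor.assocInv S T A B C).comp (Tensor.assoc S T A B C))
      (g := HeapHom.id _) (fun y c => ?_) x
    exact Tensor.hom_ext
      (f := (Tensor.assocInv S T A B C).comp (Tensor.assocAux S T A B C c))
      (g := ⟨fun y => Tensor.tmul T y c, fun y y' y'' => Tensor.br_tmul y y' y'' c⟩)
      (fun a b => rfl) y

theorem Tensor.bijective_map_toRight {S T M M' N : Type*} [UnitalTruss S] [UnitalTruss T]
    [AbHeap M] [AbHeap M'] [AbHeap N] [UModule S M] [UModule Tᵐᵒᵖ M] [UModule S M']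
    [UModule Tᵐᵒᵖ M'] [UModule T N] (f : BimodIso S T M M') :
    Function.Bijective (Tensor.map f.toRight (LinHom.id T N)) := by
  refine Function.bijective_iff_has_inverse.2
    ⟨Tensor.map f.symm.toRight (LinHom.id T N), fun x => ?_, fun x => ?_⟩
  · refine Tensor.hom_ext (g := HeapHom.id _) (f := (Tensor.map f.symm.toRight
      (LinHom.id T N)).comp (Tensor.map f.toRight (LinHom.id T N))) (fun m n => ?_) x
    exact congrArg (Tensor.tmul T · n) (f.toEquiv.symm_apply_apply m)
  · refine Tensor.hom_ext (g := HeapHom.id _) (f := (Tensor.map f.toRight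
      (LinHom.id T N)).comp (Tensor.map f.symm.toRight (LinHom.id T N))) (fun m n => ?_) x
    exact congrArg (Tensor.tmul T · n) (f.toEquiv.apply_symm_apply m)

variable {T S : Type u} [UnitalTruss T] [UnitalTruss S]

/-- The isomorphism of modules given by a bijective linear map. -/
noncomputable def UMod.isoOfBijective {M N : UMod T} (f : LinHom T M.carrier N.carrier)
    (hf : Function.Bijective f.toFun) : M ≅ N where
  hom := f
  inv :=
    { toFun := (Equiv.ofBijective _ hf).symm
      map_br := fun a b c => (Equiv.ofBijective _ hf).symm_apply_eq.2 <| by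
        refine Eq.trans ?_ (f.map_br _ _ _).symm
        exact (congr (congr (congrArg br ((Equiv.ofBijective _ hf).apply_symm_apply a))
          ((Equiv.ofBijective _ hf).apply_symm_apply b))
          ((Equiv.ofBijective _ hf).apply_symm_apply c)).symm
      map_smul := fun t m => (Equiv.ofBijective _ hf).symm_apply_eq.2
        ((f.map_smul t _).trans
          (congrArg (t • ·) ((Equiv.ofBijective _ hf).apply_symm_apply m))).symm }
  hom_inv_id := LinHom.ext (funext (Equiv.ofBijective _ hf).symm_apply_apply)
  inv_hom_id := LinHom.ext (funext (Equiv.ofBijective _ hf).apply_symm_apply)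

/-- The `S`-linear map `P ⊗ f : P ⊗ M → P ⊗ N`. -/
def tensorMap (P : UBimod S T) {M N : Type u} [AbHeap M] [AbHeap N] [UModule T M] [UModule T N]
    (f : LinHom T M N) : LinHom S (Tensor T P.carrier M) (Tensor T P.carrier N) :=
  ⟨Tensor.map (LinHom.id _ _) f, fun s x => by
    induction x using Tensor.ind with
    | hp a b => rfl
    | hb x y z hx hy hz => simp only [UModule.smul_br, HeapHom.map_br, hx, hy, hz]⟩

/-- Tensoring with an `S`-`T`-bimodule, as a functor from `T`-modules to `S`-modules. -/
def tensorFunctor (P : UBimod S T) : UMod T ⥤ UMod S where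
  obj N := ⟨Tensor T P.carrier N.carrier⟩
  map f := tensorMap P f
  map_id _ := LinHom.ext (funext (Tensor.hom_ext (g := HeapHom.id _) fun _ _ => rfl))
  map_comp f g := LinHom.ext (funext (Tensor.hom_ext (f := Tensor.map (LinHom.id _ _) _)
    (g := (Tensor.map (LinHom.id _ _) g).comp (Tensor.map (LinHom.id _ _) f)) fun _ _ => rfl))

/-- The map `P ⊗ (Q ⊗ N) → N`, `p ⊗ (q ⊗ n) ↦ ev (p ⊗ q) · n`. -/
def evalTensor (P : UBimod S T) (Q : UBimod T S)
    (ev : BimodIso S S (Tensor T P.carrier Q.carrier) S) (N : Type u) [AbHeap N] [UModule S N] :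
    HeapHom (Tensor T P.carrier (Tensor S Q.carrier N)) N :=
  (Tensor.lUnit S N).comp
    ((Tensor.map ev.toRight (LinHom.id S N)).comp
      (Tensor.assocInv T S P.carrier Q.carrier N))

theorem evalTensor_smul (P : UBimod S T) (Q : UBimod T S)
    (ev : BimodIso S S (Tensor T P.carrier Q.carrier) S) (N : Type u) [AbHeap N]
    [UModule S N] (s : S)
    (x : Tensor T P.carrier (Tensor S Q.carrier N)) :
    evalTensor P Q ev N (s • x) = s • evalTensor P Q ev N x := by
  induction x using Tensor.ind with
  | hp p y =>
    induction y using Tensor.ind with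
    | hp q n =>
      exact (congrArg (· • n) (ev.map_smul s (Tensor.tmul T p q))).trans (mul_smul s _ n)
    | hb x y z hx hy hz =>
      simp only [Tensor.tmul_br, UModule.smul_br, HeapHom.map_br, hx, hy, hz]
  | hb x y z hx hy hz => simp only [UModule.smul_br, HeapHom.map_br, hx, hy, hz]

theorem evalTensor_natural (P : UBimod S T) (Q : UBimod T S)
    (ev : BimodIso S S (Tensor T P.carrier Q.carrier) S) {N N' : Type u} [AbHeap N] [AbHeap N']
    [UModule S N] [UModule S N'] (f : LinHom S N N')
    (x : Tensor T P.carrier (Tensor S Q.carrier N)) :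
    evalTensor P Q ev N' ((tensorMap P (tensorMap Q f)).toFun x) =
      f.toFun (evalTensor P Q ev N x) := by
  induction x using Tensor.ind with
  | hp p y =>
    induction y using Tensor.ind with
    | hp q n => exact (f.map_smul (ev.toFun (Tensor.tmul T p q)) n).symm
    | hb x y z hx hy hz => simp only [Tensor.tmul_br, HeapHom.map_br, hx, hy, hz]
  | hb x y z hx hy hz => simp only [HeapHom.map_br, hx, hy, hz]

/-- The isomorphism `P ⊗ (Q ⊗ N) ≅ N`, `p ⊗ (q ⊗ n) ↦ ev (p ⊗ q) · n`. -/
noncomputable def tensorFunctorCompIso (P : UBimod S T) (Q : UBimod T S)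
    (ev : BimodIso S S (Tensor T P.carrier Q.carrier) S) :
    tensorFunctor Q ⋙ tensorFunctor P ≅ 𝟭 (UMod S) :=
  NatIso.ofComponents
    (fun N => UMod.isoOfBijective (M := (tensorFunctor Q ⋙ tensorFunctor P).obj N)
      (N := (𝟭 (UMod S)).obj N)
      ⟨evalTensor P Q ev N.carrier, evalTensor_smul P Q ev N.carrier⟩
      ((Tensor.bijective_lUnit S N.carrier).comp
        ((Tensor.bijective_map_toRight ev).comp (Tensor.bijective_assocInv _ _ _ _ _))))
    (fun f => LinHom.ext (funext (evalTensor_natural P Q ev f)))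

/-- Mutually inverse bimodules induce an equivalence of module categories. -/
noncomputable def tensorEquivalence (P : UBimod S T) (Q : UBimod T S)
    (ev : BimodIso S S (Tensor T P.carrier Q.carrier) S)
    (db : BimodIso T T T (Tensor S Q.carrier P.carrier)) : UMod T ≌ UMod S :=
  -- Any two natural isomorphisms suffice here: `CategoryTheory.Equivalence.mk` adjusts the unit to
  -- satisfy the triangle identity.
  CategoryTheory.Equivalence.mk (tensorFunctor P) (tensorFunctor Q)
    (tensorFunctorCompIso Q P db.symm).symm (tensorFunctorCompIso P Q ev)

end Tensor

/-! ### Full and faithful functors preserve brackets of morphisms -/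

/-- Linear maps form an abelian heap under the pointwise bracket. -/
instance {T M N : Type*} [UnitalTruss T] [AbHeap M] [AbHeap N] [UModule T M] [UModule T N] :
    AbHeap (LinHom T M N) where
  br f g h :=
    { toFun := fun m => br (f.toFun m) (g.toFun m) (h.toFun m)
      map_br := fun a b c => by
        rw [f.map_br, g.map_br, h.map_br, br_transpose]
      map_smul := fun t m => by rw [f.map_smul, g.map_smul, h.map_smul, UModule.smul_br] }
  br_assoc _ _ _ _ _ := LinHom.ext (funext fun _ => br_assoc _ _ _ _ _)
  br_right _ _ := LinHom.ext (funext fun _ => br_right _ _)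
  br_left _ _ := LinHom.ext (funext fun _ => br_left _ _)
  br_comm _ _ _ := LinHom.ext (funext fun _ => br_comm _ _ _)

/-- The product of two abelian heaps. -/
instance {M N : Type*} [AbHeap M] [AbHeap N] : AbHeap (M × N) where
  br a b c := (br a.1 b.1 c.1, br a.2 b.2 c.2)
  br_assoc _ _ _ _ _ := Prod.ext (br_assoc _ _ _ _ _) (br_assoc _ _ _ _ _)
  br_right _ _ := Prod.ext (br_right _ _) (br_right _ _)
  br_left _ _ := Prod.ext (br_left _ _) (br_left _ _)
  br_comm _ _ _ := Prod.ext (br_comm _ _ _) (br_comm _ _ _)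

instance {T M N : Type*} [UnitalTruss T] [AbHeap M] [AbHeap N] [UModule T M] [UModule T N] :
    UModule T (M × N) where
  br_smul _ _ _ _ := Prod.ext (UModule.br_smul _ _ _ _) (UModule.br_smul _ _ _ _)
  smul_br _ _ _ _ := Prod.ext (UModule.smul_br _ _ _ _) (UModule.smul_br _ _ _ _)

/-! ### Maps into products, and `T` as the free module on `1` -/

namespace LinHom

variable {T M N K : Type*} [UnitalTruss T] [AbHeap M] [AbHeap N] [AbHeap K]
  [UModule T M] [UModule T N] [UModule T K]

/-- The first projection. -/
def fst : LinHom T (M × N) M := ⟨⟨Prod.fst, fun _ _ _ => rfl⟩, fun _ _ => rfl⟩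

/-- The second projection. -/
def snd : LinHom T (M × N) N := ⟨⟨Prod.snd, fun _ _ _ => rfl⟩, fun _ _ => rfl⟩

/-- The map into a product with given components. -/
def prod (f : LinHom T K M) (g : LinHom T K N) : LinHom T K (M × N) :=
  ⟨⟨fun k => (f.toFun k, g.toFun k), fun _ _ _ => Prod.ext (f.map_br _ _ _) (g.map_br _ _ _)⟩,
    fun _ _ => Prod.ext (f.map_smul _ _) (g.map_smul _ _)⟩

theorem comp_br (e : LinHom T N K) (f g h : LinHom T M N) :
    e.comp (br f g h) = br (e.comp f) (e.comp g) (e.comp h) :=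
  LinHom.ext (funext fun _ => e.map_br _ _ _)

/-- The map `T → M`, `t ↦ t • m`. -/
def orbit (T : Type*) {M : Type*} [UnitalTruss T] [AbHeap M] [UModule T M] (m : M) :
    LinHom T T M :=
  ⟨⟨fun t => t • m, fun _ _ _ => UModule.br_smul _ _ _ _⟩, fun _ _ => mul_smul _ _ _⟩

theorem orbit_br (m m' m'' : M) :
    orbit T (br m m' m'') = br (orbit T m) (orbit T m') (orbit T m'') :=
  LinHom.ext (funext fun t => UModule.smul_br t m m' m'')

theorem comp_orbit (f : LinHom T M N) (m : M) : f.comp (orbit T m) = orbit T (f.toFun m) :=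
  LinHom.ext (funext fun t => f.map_smul t m)

theorem eq_orbit (f : LinHom T T M) : f = orbit T (f.toFun 1) :=
  LinHom.ext (funext fun t => by
    refine Eq.trans ?_ (f.map_smul t 1)
    rw [smul_eq_mul, mul_one])

end LinHom

section Functor

variable {T S : Type u} [UnitalTruss T] [UnitalTruss S] (F : UMod T ⥤ UMod S)

/-- The action of a functor on linear maps. -/
def mapLin {M N : UMod T} (f : LinHom T M.carrier N.carrier) :
    LinHom S (F.obj M).carrier (F.obj N).carrier :=
  F.map (X := M) (Y := N) f

theorem mapLin_id (M : UMod T) : mapLin F (LinHom.id T M.carrier) = LinHom.id S _ := F.map_id M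

theorem mapLin_comp {M N K : UMod T} (g : LinHom T N.carrier K.carrier)
    (f : LinHom T M.carrier N.carrier) :
    mapLin F (M := M) (N := K) (g.comp f) = (mapLin F g).comp (mapLin F f) :=
  F.map_comp (X := M) (Y := N) (Z := K) f g

theorem mapLin_injective [F.Faithful] {M N : UMod T} :
    Function.Injective (mapLin F (M := M) (N := N)) :=
  F.map_injective (X := M) (Y := N)

theorem mapLin_surjective [F.Full] {M N : UMod T} :
    Function.Surjective (mapLin F (M := M) (N := N)) :=
  F.map_surjective (X := M) (Y := N)

/-- A full and faithful functor preserves brackets of linear maps: the bracket of a module `N` is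
the unique Mal'cev operation `N × N × N → N` in the category of modules. -/
theorem mapLin_br [F.Full] [F.Faithful] {M N : UMod T} (f g h : LinHom T M.carrier N.carrier) :
    mapLin F (br f g h) = br (mapLin F f) (mapLin F g) (mapLin F h) := by
  let X : UMod T := ⟨N.carrier × N.carrier × N.carrier⟩
  let p : LinHom T X.carrier N.carrier := LinHom.fst
  let q : LinHom T X.carrier N.carrier := LinHom.fst.comp LinHom.snd
  let r : LinHom T X.carrier N.carrier := LinHom.snd.comp LinHom.snd
  let tup {M : UMod T} (f g h : LinHom T M.carrier N.carrier) : LinHom T M.carrier X.carrier :=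
    f.prod (g.prod h)
  -- Fullness supplies `w` whose image is the bracket of the images of `(p, q, q)`, `(q, q, q)`,
  -- `(q, q, r)`. In each coordinate, and also after applying `[p, q, r]`, these triples collapse by
  -- the Mal'cev identities. The coordinates force `w = id` by faithfulness, and `[p, q, r]` then
  -- gives the claim in the universal case. Preservation of products by `F` is never needed.
  obtain ⟨w, hw⟩ := mapLin_surjective F (M := X) (N := X)
    (br (mapLin F (tup p q q)) (mapLin F (tup q q q)) (mapLin F (tup q q r)))
  have hcomp (e : LinHom T X.carrier N.carrier) : mapLin F (M := X) (N := N) (e.comp w) =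
      br (mapLin F (M := X) (N := N) (e.comp (tup p q q)))
        (mapLin F (M := X) (N := N) (e.comp (tup q q q)))
        (mapLin F (M := X) (N := N) (e.comp (tup q q r))) := by
    rw [mapLin_comp, hw, LinHom.comp_br, mapLin_comp, mapLin_comp, mapLin_comp]
  have hwid : w = LinHom.id T X.carrier := by
    have h₁ : p.comp w = p := mapLin_injective F ((hcomp p).trans (br_right _ _))
    have h₂ : q.comp w = q := mapLin_injective F ((hcomp q).trans (br_right _ _))
    have h₃ : r.comp w = r := mapLin_injective F ((hcomp r).trans (br_left _ _))
    refine LinHom.ext (funext fun x => Prod.ext ?_ (Prod.ext ?_ ?_))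
    · exact congrArg (fun k => k.toFun x) h₁
    · exact congrArg (fun k => k.toFun x) h₂
    · exact congrArg (fun k => k.toFun x) h₃
  have hμ : mapLin F (br p q r) = br (mapLin F p) (mapLin F q) (mapLin F r) := by
    have h := hcomp (br p q r)
    rw [hwid, show (br p q r).comp (tup p q q) = p from LinHom.ext (funext fun _ => br_right _ _),
      show (br p q r).comp (tup q q q) = q from LinHom.ext (funext fun _ => br_right _ _),
      show (br p q r).comp (tup q q r) = r from LinHom.ext (funext fun _ => br_left _ _)] at h
    exact h
  -- The general case is pulled back from the universal one: `[f, g, h] = [p, q, r] ∘ (f, g, h)`.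
  calc mapLin F (br f g h) = (mapLin F (br p q r)).comp (mapLin F (tup f g h)) :=
        mapLin_comp F (br p q r) (tup f g h)
    _ = br ((mapLin F p).comp (mapLin F (tup f g h))) ((mapLin F q).comp (mapLin F (tup f g h)))
        ((mapLin F r).comp (mapLin F (tup f g h))) := by rw [hμ]; rfl
    _ = br (mapLin F f) (mapLin F g) (mapLin F h) := by
        rw [← mapLin_comp, ← mapLin_comp, ← mapLin_comp]; rfl

/-! ### The bimodule of a full and faithful functor -/

variable (T) in
/-- A truss as a module over itself. -/
abbrev UMod.self : UMod T := ⟨T⟩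

/-- The map `F T → F M` induced by `T → M`, `t ↦ t • m`. -/
def mapOrbit {M : UMod T} (m : M.carrier) :
    LinHom S (F.obj (UMod.self T)).carrier (F.obj M).carrier :=
  mapLin F (M := UMod.self T) (LinHom.orbit T m)

/-- The orbit map of `f m` is `f` after the orbit map of `m`. This expresses naturality of the
comparison map in `M`. -/
theorem mapOrbit_toFun {M N : UMod T} (f : LinHom T M.carrier N.carrier) (m : M.carrier) :
    mapOrbit F (f.toFun m) = (mapLin F f).comp (mapOrbit F m) := by
  rw [mapOrbit, ← LinHom.comp_orbit]
  exact mapLin_comp F (M := UMod.self T) f (LinHom.orbit T m)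

/-- The reversed order makes the action of `T` on `F T` a right action, and the same identity makes
the comparison map balanced. -/
theorem mapOrbit_smul {M : UMod T} (t : T) (m : M.carrier) :
    mapOrbit F (t • m) = (mapOrbit F m).comp (mapOrbit F (M := UMod.self T) t) :=
  mapOrbit_toFun F (M := UMod.self T) (LinHom.orbit T m) t

theorem mapOrbit_br [F.Full] [F.Faithful] {M : UMod T} (m m' m'' : M.carrier) :
    mapOrbit F (br m m' m'') = br (mapOrbit F m) (mapOrbit F m') (mapOrbit F m'') := by
  rw [mapOrbit, LinHom.orbit_br]
  exact mapLin_br F (M := UMod.self T) _ _ _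

theorem mapOrbit_one : mapOrbit F (M := UMod.self T) (1 : T) = LinHom.id S _ := by
  rw [mapOrbit, show LinHom.orbit T (1 : T) = LinHom.id T T from
    LinHom.ext (funext fun t => mul_one t)]
  exact mapLin_id F (UMod.self T)

/-- The right `T`-module structure on `F T`, by functoriality. -/
abbrev imageRightModule [F.Full] [F.Faithful] :
    UModule Tᵐᵒᵖ (F.obj (UMod.self T)).carrier where
  smul t p := (mapOrbit F (M := UMod.self T) t.unop).toFun p
  one_smul p := congrArg (fun f => f.toFun p) (mapOrbit_one F)
  -- Multiplication in `Tᵐᵒᵖ` is reversed, which matches the reversal in `mapOrbit_smul`.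
  mul_smul t t' p :=
    congrArg (fun f => f.toFun p) (mapOrbit_smul F (M := UMod.self T) t'.unop t.unop)
  br_smul t t' t'' p := congrArg (fun f => f.toFun p)
    (mapOrbit_br F (M := UMod.self T) t.unop t'.unop t''.unop)
  smul_br t := (mapOrbit F (M := UMod.self T) t.unop).map_br

/-- The `S`-`T`-bimodule `F T`. -/
def imageBimod [F.Full] [F.Faithful] : UBimod S T :=
  letI := imageRightModule F
  { carrier := (F.obj (UMod.self T)).carrier
    comm := ⟨fun s t p => ((mapOrbit F (M := UMod.self T) t.unop).map_smul s p).symm⟩ }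

/-- The comparison map `F T ⊗ M → F M`, `p ⊗ m ↦ F (t ↦ t • m) p`. -/
def comparison [F.Full] [F.Faithful] (M : UMod T) :
    LinHom S (Tensor T (imageBimod F).carrier M.carrier) (F.obj M).carrier where
  toHeapHom := Tensor.lift
    { toFun := fun p m => (mapOrbit F m).toFun p
      br_left := fun p p' p'' m => (mapOrbit F m).map_br p p' p''
      br_right := fun p m m' m'' => congrArg (fun f => f.toFun p) (mapOrbit_br F m m' m'')
      balanced := fun p t m => (congrArg (fun f => f.toFun p) (mapOrbit_smul F t m)).symm }
  map_smul s x := by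
    induction x using Tensor.ind with
    | hp p m => exact (mapOrbit F m).map_smul s p
    | hb x y z hx hy hz => simp only [UModule.smul_br, HeapHom.map_br, hx, hy, hz]

end Functor

/-! ### The adjunction of an equivalence, and bijectivity of the comparison map -/

section Equivalence

variable {T S : Type u} [UnitalTruss T] [UnitalTruss S] (E : UMod T ≌ UMod S)

/-- The unit of an equivalence as a linear map. -/
def unitLin (M : UMod T) : LinHom T M.carrier (E.inverse.obj (E.functor.obj M)).carrier :=
  E.unit.app M

/-- The counit of an equivalence as a linear map. -/
def counitLin (N : UMod S) : LinHom S (E.functor.obj (E.inverse.obj N)).carrier N.carrier :=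
  E.counit.app N

theorem unitLin_natural {M M' : UMod T} (f : LinHom T M.carrier M'.carrier) :
    (mapLin E.inverse (mapLin E.functor f)).comp (unitLin E M) = (unitLin E M').comp f :=
  (E.unit.naturality (X := M) (Y := M') f).symm

theorem counitLin_natural {N N' : UMod S} (f : LinHom S N.carrier N'.carrier) :
    (counitLin E N').comp (mapLin E.functor (mapLin E.inverse f)) = f.comp (counitLin E N) :=
  E.counit.naturality (X := N) (Y := N') f

theorem counitLin_comp_map_unitLin (M : UMod T) :
    (counitLin E (E.functor.obj M)).comp (mapLin E.functor (unitLin E M)) = LinHom.id S _ :=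
  E.functor_unit_comp M

theorem map_counitLin_comp_unitLin (N : UMod S) :
    (mapLin E.inverse (counitLin E N)).comp (unitLin E (E.inverse.obj N)) = LinHom.id T _ :=
  E.unit_inverse_comp N

theorem bijective_counitLin (N : UMod S) : Function.Bijective (counitLin E N).toFun := by
  let i : LinHom S N.carrier (E.functor.obj (E.inverse.obj N)).carrier := E.counitIso.inv.app N
  have h₁ : i.comp (counitLin E N) = LinHom.id S _ := E.counitIso.hom_inv_id_app N
  have h₂ : (counitLin E N).comp i = LinHom.id S _ := E.counitIso.inv_hom_id_app N
  exact Function.bijective_iff_has_inverse.2 ⟨i.toFun,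
    fun x => congrArg (fun f => f.toFun x) h₁, fun x => congrArg (fun f => f.toFun x) h₂⟩

/-- One half of the bijection `Hom (F M, N) ≅ Hom (M, G N)`: naturality of the counit followed by a
triangle identity. -/
theorem counitLin_comp_map_transpose {M : UMod T} {N : UMod S}
    (h : LinHom S (E.functor.obj M).carrier N.carrier) :
    (counitLin E N).comp (mapLin E.functor ((mapLin E.inverse h).comp (unitLin E M))) = h := by
  rw [mapLin_comp]
  refine (congrArg (LinHom.comp · (mapLin E.functor (unitLin E M)))
    (counitLin_natural E h)).trans ?_
  exact congrArg (LinHom.comp h) (counitLin_comp_map_unitLin E M)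

theorem map_transpose_comp_unitLin {M : UMod T} {N : UMod S}
    (h : LinHom T M.carrier (E.inverse.obj N).carrier) :
    (mapLin E.inverse ((counitLin E N).comp (mapLin E.functor h))).comp (unitLin E M) = h := by
  rw [mapLin_comp]
  refine (congrArg (LinHom.comp (mapLin E.inverse (counitLin E N)))
    (unitLin_natural E h)).trans ?_
  exact congrArg (LinHom.comp · h) (map_counitLin_comp_unitLin E N)

/-- The element of `G N` that corresponds to a linear map `F T → N`. -/
def transposeElem {N : UMod S} (h : LinHom S (E.functor.obj (UMod.self T)).carrier N.carrier) :
    (E.inverse.obj N).carrier :=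
  (mapLin E.inverse h).toFun ((unitLin E (UMod.self T)).toFun (1 : T))

/-- A linear map out of `T` is the orbit map of its value at `1`, so the adjunct of `h` is recovered
from the single element `transposeElem E h`. -/
theorem counitLin_comp_mapOrbit_transposeElem {N : UMod S}
    (h : LinHom S (E.functor.obj (UMod.self T)).carrier N.carrier) :
    (counitLin E N).comp (mapOrbit E.functor (transposeElem E h)) = h := by
  have : LinHom.orbit T (transposeElem E h) =
      (mapLin E.inverse h).comp (unitLin E (UMod.self T)) :=
    (LinHom.eq_orbit ((mapLin E.inverse h).comp (unitLin E (UMod.self T)))).symm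
  rw [mapOrbit, this]
  exact counitLin_comp_map_transpose E (M := UMod.self T) h

theorem transposeElem_comp {N N' : UMod S} (g : LinHom S N.carrier N'.carrier)
    (h : LinHom S (E.functor.obj (UMod.self T)).carrier N.carrier) :
    transposeElem E (g.comp h) = (mapLin E.inverse g).toFun (transposeElem E h) := by
  rw [transposeElem, mapLin_comp]
  rfl

theorem transposeElem_mapOrbit {M : UMod T} (m : M.carrier) :
    transposeElem E (mapOrbit E.functor m) = (unitLin E M).toFun m := by
  refine (congrArg (fun f => f.toFun (1 : T))
    (unitLin_natural E (M := UMod.self T) (LinHom.orbit T m))).trans ?_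
  exact congrArg (unitLin E M).toFun (one_smul T m)

/-- The passage from maps `F T → N` to elements of `G N` is `T`-linear when `T` acts on the maps by
precomposition. This is the linearity of `comparisonTranspose`. -/
theorem transposeElem_comp_mapOrbit {N : UMod S}
    (h : LinHom S (E.functor.obj (UMod.self T)).carrier N.carrier) (t : T) :
    transposeElem E (h.comp (mapOrbit E.functor (M := UMod.self T) t)) =
      t • transposeElem E h := by
  rw [transposeElem_comp, transposeElem_mapOrbit, transposeElem, ← LinHom.map_smul,
    ← LinHom.map_smul, smul_eq_mul, mul_one]

theorem transposeElem_br {N : UMod S}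
    (h h' h'' : LinHom S (E.functor.obj (UMod.self T)).carrier N.carrier) :
    transposeElem E (br h h' h'') =
      br (transposeElem E h) (transposeElem E h') (transposeElem E h'') := by
  rw [transposeElem, mapLin_br]
  rfl

/-- The map `F T → F T ⊗ M`, `p ↦ p ⊗ m`. -/
def tmulRight {M : UMod T} (m : M.carrier) : LinHom S (E.functor.obj (UMod.self T)).carrier
    (UMod.mk (T := S) (Tensor T (imageBimod E.functor).carrier M.carrier)).carrier :=
  ⟨⟨fun p => Tensor.tmul T (M := (imageBimod E.functor).carrier) p m,
    fun p p' p'' => Tensor.br_tmul (M := (imageBimod E.functor).carrier) p p' p'' m⟩,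
    fun _ _ => rfl⟩

/-- The map `M → G (F T ⊗ M)` that corresponds to `m ↦ (p ↦ p ⊗ m)`. -/
def comparisonTranspose (M : UMod T) : LinHom T M.carrier
    (E.inverse.obj ⟨Tensor T (imageBimod E.functor).carrier M.carrier⟩).carrier where
  toFun m := transposeElem E (tmulRight E m)
  map_br m m' m'' := by
    rw [← transposeElem_br]
    exact congrArg (transposeElem E) (LinHom.ext (funext fun p =>
      Tensor.tmul_br (T := T) (M := (imageBimod E.functor).carrier) p m m' m''))
  map_smul t m := by
    rw [← transposeElem_comp_mapOrbit]
    exact congrArg (transposeElem E) (LinHom.ext (funext fun p =>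
      (Tensor.balance (T := T) (M := (imageBimod E.functor).carrier) p t m).symm))

/-- Every equivalence of module categories is given by tensoring with a bimodule. -/
theorem bijective_comparison (M : UMod T) :
    Function.Bijective (comparison E.functor M).toFun := by
  let X : UMod S := ⟨Tensor T (imageBimod E.functor).carrier M.carrier⟩
  let θ : LinHom S X.carrier (E.functor.obj M).carrier := comparison E.functor M
  -- The candidate inverse is the adjunct of `M → G (F T ⊗ M)`.
  let σ : LinHom S (E.functor.obj M).carrier X.carrier :=
    (counitLin E X).comp (mapLin E.functor (comparisonTranspose E M))
  have hσθ (x : X.carrier) : σ.toFun (θ.toFun x) = x := by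
    refine Tensor.hom_ext (f := (σ.comp θ).toHeapHom) (g := HeapHom.id _) (fun p m => ?_) x
    refine (congrArg (fun f => (counitLin E X).toFun (f.toFun p))
      (mapOrbit_toFun E.functor (N := E.inverse.obj X) (comparisonTranspose E M) m)).symm.trans ?_
    exact congrArg (fun f => f.toFun p)
      (counitLin_comp_mapOrbit_transposeElem E (N := X) (tmulRight E m))
  have hθσ : θ.comp σ = LinHom.id S (E.functor.obj M).carrier := by
    -- Two maps out of `F M` agree once their adjuncts `M → G (F M)` do; at `m` both adjuncts have
    -- the value `η m`, with `η` the unit.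
    rw [← counitLin_comp_map_transpose E (θ.comp σ), ← counitLin_comp_map_transpose E
      (LinHom.id S (E.functor.obj M).carrier)]
    congr 2
    refine LinHom.ext (funext fun m => ?_)
    have h₁ : (mapLin E.inverse (θ.comp σ)).comp (unitLin E M) =
        (mapLin E.inverse θ).comp (comparisonTranspose E M) := by
      rw [mapLin_comp (N := X)]
      exact congrArg (LinHom.comp (mapLin E.inverse θ))
        (map_transpose_comp_unitLin E (N := X) (comparisonTranspose E M))
    rw [h₁, mapLin_id]
    refine (transposeElem_comp E θ (tmulRight E m)).symm.trans ?_
    exact transposeElem_mapOrbit E m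
  exact Function.bijective_iff_has_inverse.2
    ⟨σ.toFun, hσθ, fun y => congrArg (fun f => f.toFun y) hθσ⟩

/-! ### Evaluation and its associativity -/

/-- The evaluation isomorphism `F T ⊗ G S ≅ F (G S) ≅ S`. -/
noncomputable def evalIso : BimodIso S S
    (Tensor T (imageBimod E.functor).carrier (imageBimod E.inverse).carrier) S where
  toEquiv := Equiv.ofBijective _ ((bijective_counitLin E (UMod.self S)).comp
    (bijective_comparison E (E.inverse.obj (UMod.self S))))
  map_br := ((counitLin E (UMod.self S)).comp
    (comparison E.functor (E.inverse.obj (UMod.self S)))).map_br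
  map_smul := ((counitLin E (UMod.self S)).comp
    (comparison E.functor (E.inverse.obj (UMod.self S)))).map_smul
  map_op_smul s x := by
    let ev : LinHom S (Tensor T (imageBimod E.functor).carrier (imageBimod E.inverse).carrier) S :=
      (counitLin E (UMod.self S)).comp (comparison E.functor (E.inverse.obj (UMod.self S)))
    -- Right multiplication by `s` is the left linear map `g`, and the right action on `G S` is `G
    -- g`; so right linearity is naturality of the counit at `g`.
    let g : LinHom S S S := LinHom.orbit S s
    let r : HeapHom (Tensor T (imageBimod E.functor).carrier (imageBimod E.inverse).carrier)
      (Tensor T (imageBimod E.functor).carrier (imageBimod E.inverse).carrier) :=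
      ⟨fun x => op s • x, UModule.smul_br (op s)⟩
    refine Tensor.hom_ext (f := ev.toHeapHom.comp r) (g := g.toHeapHom.comp ev.toHeapHom)
      (fun p q => ?_) x
    refine (congrArg (fun f => (counitLin E (UMod.self S)).toFun (f.toFun p))
      (mapOrbit_toFun E.functor (M := E.inverse.obj (UMod.self S))
        (N := E.inverse.obj (UMod.self S)) (mapOrbit E.inverse (M := UMod.self S) s) q)).trans ?_
    exact congrArg (fun f => f.toFun ((mapOrbit E.functor q).toFun p))
      (counitLin_natural E (N := UMod.self S) (N' := UMod.self S) g)

/-- A triangle identity, since the counit of `E.symm` is the inverse of the unit of `E`. -/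
theorem counitLin_eq_map_counitLin_symm (M : UMod T) :
    counitLin E (E.functor.obj M) = mapLin E.functor (counitLin E.symm M) :=
  E.counit_app_functor M

/-- Evaluation is compatible with the actions: `ev (p ⊗ q) · p' = p · ev' (q ⊗ p')`. -/
theorem evalIso_smul (p : (imageBimod E.functor).carrier) (q : (imageBimod E.inverse).carrier)
    (p' : (imageBimod E.functor).carrier) :
    (evalIso E).toFun (Tensor.tmul T p q) • p' =
      op ((evalIso E.symm).toFun (Tensor.tmul S q p')) • p := by
  let FT : UMod S := E.functor.obj (UMod.self T)
  let f : LinHom S S FT.carrier := LinHom.orbit S p'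
  -- The element `y` is the comparison image of `q ⊗ p'` in `G (F T)`, so the counit of `E.symm`
  -- takes it to the evaluation of `q ⊗ p'`.
  let y : (E.inverse.obj FT).carrier := (mapLin E.inverse (M := UMod.self S) f).toFun q
  calc f.toFun ((evalIso E).toFun (Tensor.tmul T p q))
      = (counitLin E FT).toFun ((mapLin E.functor (mapLin E.inverse (M := UMod.self S) f)).toFun
          ((mapOrbit E.functor (M := E.inverse.obj (UMod.self S)) q).toFun p)) :=
        congrArg (fun g => g.toFun
          ((mapOrbit E.functor (M := E.inverse.obj (UMod.self S)) q).toFun p))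
          (counitLin_natural E (N := UMod.self S) (N' := FT) f).symm
    _ = (counitLin E FT).toFun ((mapOrbit E.functor (M := E.inverse.obj FT) y).toFun p) :=
        congrArg (fun g => (counitLin E FT).toFun (g.toFun p))
          (mapOrbit_toFun E.functor (mapLin E.inverse (M := UMod.self S) f) q).symm
    _ = (mapLin E.functor (counitLin E.symm (UMod.self T))).toFun
          ((mapOrbit E.functor (M := E.inverse.obj FT) y).toFun p) :=
        congrArg (fun g => g.toFun ((mapOrbit E.functor (M := E.inverse.obj FT) y).toFun p))
          (counitLin_eq_map_counitLin_symm E (UMod.self T))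
    _ = (mapOrbit E.functor (M := UMod.self T)
          ((counitLin E.symm (UMod.self T)).toFun y)).toFun p :=
        congrArg (fun g => g.toFun p) (mapOrbit_toFun E.functor (M := E.inverse.obj FT)
          (N := UMod.self T) (counitLin E.symm (UMod.self T)) y).symm

end Equivalence

end TrussTheory

theorem theorem4p5 (T S : Type u) [UnitalTruss T] [UnitalTruss S] :
    List.TFAE
      [Nonempty (CategoryTheory.Equivalence (UMod T) (UMod S)),
       ∃ (P : UBimod S T) (Q : UBimod T S)
         (ev : BimodIso S S (Tensor T P.carrier Q.carrier) S)
         (db : BimodIso T T T (Tensor S Q.carrier P.carrier)),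
         Zigzag₁ Q P db ev ∧ Zigzag₂ Q P db ev,
       ∃ (P : UBimod S T) (Q : UBimod T S)
         (db' : BimodIso S S S (Tensor T P.carrier Q.carrier))
         (ev' : BimodIso T T (Tensor S Q.carrier P.carrier) T),
         Zigzag₁ P Q db' ev' ∧ Zigzag₂ P Q db' ev'] := by
  -- The two zigzags are the associativity law for `E.symm` and for `E`.
  tfae_have 1 → 2
  | ⟨E⟩ => ⟨imageBimod E.functor, imageBimod E.inverse, evalIso E, (evalIso E.symm).symm,
      (zigzag₁_iff _ _ _ _).2 (evalIso_smul E.symm), (zigzag₂_iff _ _ _ _).2 (evalIso_smul E)⟩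
  tfae_have 2 → 1
  | ⟨P, Q, ev, db, _, _⟩ => ⟨tensorEquivalence P Q ev db⟩
  tfae_have 2 → 3
  | ⟨P, Q, ev, db, h₁, h₂⟩ =>
    ⟨P, Q, ev.symm, db.symm, zigzag₁_symm Q P db ev h₂, zigzag₂_symm Q P db ev h₁⟩
  tfae_have 3 → 2
  | ⟨P, Q, db, ev, h₁, h₂⟩ =>
    ⟨P, Q, db.symm, ev.symm, zigzag₁_symm P Q db ev h₂, zigzag₂_symm P Q db ev h₁⟩
  tfae_finish
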